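/- Let $n_1,n_2,n_3\ge 2$. For $\mathcal X\in\mathbb R^{n_1\times n_2\times n_3}$ write $\mathbf X^{(k)}$ for its $k$-th frontal slice, $(\mathbf X^{(k)})_{ij}=\mathcal X_{ijk}$, and $\|\mathcal X\|_F^2=\sum_{i,j,k}\mathcal X_{ijk}^2$; $\|\mathcal X\|_0$ is the number of nonzero entries. The tensor-tensor product of $\mathcal A\in\mathbb R^{n_1\times r\times n_3}$ and $\mathcal B\in\mathbb R^{r\times n_2\times n_3}$ is the tensor $\mathcal A\diamond\mathcal B\in\mathbb R^{n_1\times n_2\times n_3}$ obtained by multiplying the block circulant matrix with first block column $(\mathbf A^{(1)},\dots,\mathbf A^{(n_3)})$ by the matrix in which $\mathbf B^{(1)},\dots,\mathbf B^{(n_3)}$ are stacked vertically, and reading the result as a stack of frontal slices. For $b\ge 0$ and integers $r,s\ge 0$ let $$\mathfrak U(r,b,s)=\Big\{\mathcal X=\mathcal A\diamond\mathcal B\in\mathbb R_+^{n_1\times n_2\times n_3}:\ \mathcal A\in\mathbb R^{n_1\times r\times n_3},\ 0\le\mathcal A_{ijk}\le 1,\ \ \mathcal B\in\mathbb R^{r\times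 n_2\times n_3},\ 0\le\mathcal B_{ijk}\le b,\ \|\mathcal B\|_0\le s\Big\},$$ and let $\Delta=\min\{1,\frac{s}{n_2n_3}\}$. Let $1\le m\le n_1n_2n_3$ be an integer and let $\Omega$ be a random set of positions which contains each $(i,j,k)$ independently with probability $\gamma=\frac{m}{n_1n_2n_3}$. For $\mathcal X^*\in\mathfrak U(r,b,s)$ one observes $\Omega$ and $\mathcal Y_\Omega=(\mathcal Y_{ijk})_{(i,j,k)\in\Omega}$, where $\mathcal Y_{ijk}=\mathcal X^*_{ijk}+\epsilon_{ijk}$ and the $\epsilon_{ijk}$ are independent of each other and of $\Omega$ and have the Laplace$(0,\tau)$ distribution, with density $\frac1{2\tau}e^{-|x|/\tau}$, $\tau>0$. There exist absolute constants $C,\beta_c>0$ such that, for all such $n_1,n_2,n_3,m,b,\tau$ and all $r,s$ with $r\le\min\{n_1,n_2\}$ and $r\le s\le rn_2n_3$, $$\inf_{\widetilde{\mathcal X}}\ \sup_{\mathcal X^*\in\mathfrak U(r,b,s)}\frac{\mathbb E_{\Omega,\mathcal Y_\Omega}\|\widetilde{\mathcal X}-\mathcal X^*\|_F^2}{n_1n_2n_3}\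 \ge\ C\min\left\{\Delta b^2,\ \beta_c^2\tau^2\left(\frac{s+rn_1n_3}{m}\right)\right\},$$ where the infimum is over all estimators, i.e. all measurable functions $\widetilde{\mathcal X}$ of $(\Omega,\mathcal Y_\Omega)$ with values in $\mathbb R^{n_1\times n_2\times n_3}$. -/

import Mathlib

open MeasureTheory ProbabilityTheory
open scoped ENNReal

namespace SparseNTF

/-- Real third-order tensors of size `n₁ × n₂ × n₃`, with entries `X i j k`. -/
abbrev Tensor (n₁ n₂ n₃ : ℕ) : Type := Fin n₁ → Fin n₂ → Fin n₃ → ℝ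

/-- Positions of the entries of an `n₁ × n₂ × n₃` tensor. -/
abbrev Idx (n₁ n₂ n₃ : ℕ) : Type := Fin n₁ × Fin n₂ × Fin n₃

/-- Stack the frontal slices `X⁽¹⁾, …, X⁽ⁿ³⁾` vertically; a row is indexed by the number of the
slice and the row within that slice. -/
def unfold {n₁ n₂ n₃ : ℕ} (X : Tensor n₁ n₂ n₃) : Matrix (Fin n₃ × Fin n₁) (Fin n₂) ℝ :=
  Matrix.of fun p j => X p.2 j p.1

/-- The inverse of `unfold`. -/
def fold {n₁ n₂ n₃ : ℕ} (M : Matrix (Fin n₃ × Fin n₁) (Fin n₂) ℝ) : Tensor n₁ n₂ n₃ :=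
  fun i j k => M (k, i) j

/-- The block circulant matrix whose first block column consists of the blocks
`M⁽¹⁾, …, M⁽ⁿ³⁾` of `M`; its block in position `(k, l)` is the block of `M` of number `k - l`
(subtraction in `Fin n₃` is modulo `n₃`). -/
def circ {n₁ n₂ n₃ : ℕ} (M : Matrix (Fin n₃ × Fin n₁) (Fin n₂) ℝ) :
    Matrix (Fin n₃ × Fin n₁) (Fin n₃ × Fin n₂) ℝ :=
  Matrix.of fun p q => M (p.1 - q.1, p.2) q.2

/-- The tensor-tensor product `X ⋄ Y = Fold (Circ (Unfold X) * Unfold Y)`. -/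
def tenProd {n₁ n₂ n₃ n₄ : ℕ} (X : Tensor n₁ n₂ n₃) (Y : Tensor n₂ n₄ n₃) : Tensor n₁ n₄ n₃ :=
  fold (circ (unfold X) * unfold Y)

/-- The number of nonzero entries of a tensor. -/
noncomputable def l0 {n₁ n₂ n₃ : ℕ} (X : Tensor n₁ n₂ n₃) : ℕ :=
  Set.ncard {p : Idx n₁ n₂ n₃ | X p.1 p.2.1 p.2.2 ≠ 0}

/-- The squared Frobenius norm of a tensor. -/
def frobSq {n₁ n₂ n₃ : ℕ} (X : Tensor n₁ n₂ n₃) : ℝ :=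
  ∑ i, ∑ j, ∑ k, X i j k ^ 2

/-- The class `𝔘(r, b, s)`: nonnegative tensors `A ⋄ B` with `A` of size `n₁ × r × n₃` and entries
in `[0, 1]`, and `B` of size `r × n₂ × n₃` with entries in `[0, b]`, at most `s` of them nonzero. -/
def candidates (n₁ n₂ n₃ r : ℕ) (b : ℝ) (s : ℕ) : Set (Tensor n₁ n₂ n₃) :=
  {X | (∀ i j k, 0 ≤ X i j k) ∧
    ∃ (A : Tensor n₁ r n₃) (B : Tensor r n₂ n₃), X = tenProd A B ∧
      (∀ i j k, 0 ≤ A i j k ∧ A i j k ≤ 1) ∧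
      (∀ i j k, 0 ≤ B i j k ∧ B i j k ≤ b) ∧
      l0 B ≤ s}

/-- The Laplace distribution with location `μ` and diversity `τ`. -/
noncomputable def laplaceMeasure (μ τ : ℝ) : Measure ℝ :=
  volume.withDensity fun x => ENNReal.ofReal (1 / (2 * τ) * Real.exp (-|x - μ| / τ))

/-- The law of a noise tensor (indexed by positions) with independent `Laplace(0, τ)` entries. -/
noncomputable def noiseLaw (n₁ n₂ n₃ : ℕ) (τ : ℝ) : Measure (Idx n₁ n₂ n₃ → ℝ) :=
  Measure.pi fun _ => laplaceMeasure 0 τ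

/-- The vector `Y_Ω` of the entries of `Y = X + ε` at the positions in `Ω`. -/
def observe {n₁ n₂ n₃ : ℕ} (X : Tensor n₁ n₂ n₃) (Ω : Set (Idx n₁ n₂ n₃))
    (ε : Idx n₁ n₂ n₃ → ℝ) : Ω → ℝ :=
  fun p => X p.1.1 p.1.2.1 p.1.2.2 + ε p.1

/-- An estimator: an arbitrary measurable function of the observed data `(Ω, Y_Ω)`. (There are only
finitely many `Ω`, so measurability is a condition for each `Ω` separately.) -/
structure Estimator (n₁ n₂ n₃ : ℕ) where
  toFun : (Ω : Set (Idx n₁ n₂ n₃)) → (Ω → ℝ) → Tensor n₁ n₂ n₃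
  measurable_toFun : ∀ Ω, Measurable (toFun Ω)

/-- The risk `𝔼_{Ω, Y_Ω} ‖T - X‖_F² / (n₁ n₂ n₃)`, an element of `[0, ∞]`. The random set `Ω`
contains each position independently with probability `γ`, and is independent of the noise. -/
noncomputable def risk {n₁ n₂ n₃ : ℕ} (γ : unitInterval) (τ : ℝ)
    (T : Estimator n₁ n₂ n₃) (X : Tensor n₁ n₂ n₃) : ℝ≥0∞ :=
  (∫⁻ Ω, ∫⁻ ε, ENNReal.ofReal (frobSq (T.toFun Ω (observe X Ω ε) - X)) ∂noiseLaw n₁ n₂ n₃ τ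
    ∂setBernoulli Set.univ γ) / ((n₁ * n₂ * n₃ : ℕ) : ℝ≥0∞)

/-- The minimax risk over `𝔘(r, b, s)`, the infimum being taken over all estimators. -/
noncomputable def minimaxRisk (n₁ n₂ n₃ r : ℕ) (b : ℝ) (s : ℕ) (γ : unitInterval) (τ : ℝ) :
    ℝ≥0∞ :=
  ⨅ T : Estimator n₁ n₂ n₃, ⨆ X ∈ candidates n₁ n₂ n₃ r b s, risk γ τ T X

/-- `Δ = min {1, s / (n₂ n₃)}`. -/
noncomputable def Delta (n₂ n₃ s : ℕ) : ℝ := min 1 ((s : ℝ) / ((n₂ : ℝ) * n₃))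

end SparseNTF

/-! The bound follows Assouad's scheme, with Le Cam's two-point inequality applied entry by entry.
Two Laplace laws whose locations differ by `δ` have Hellinger affinity at least `1 - δ²/(4τ²)`
(`one_sub_le_laplaceAffinity`). Affinities multiply over independent coordinates, so two tensors are
hard to tell apart as long as `γ` times their squared distance is small compared with `τ²`
(`two_point_entryRisk_le`).

Take a cube of tensors in which each bit switches at most `M` entries between `0` and `β`. If `γMβ²
≤ τ²`, flipping one bit is nearly invisible, so each of the `#S` switched positions costs order `β²`
on average over the cube (`hypercube_lower_bound`). The largest such `β ≤ b` produces the minimum of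
two terms.

Two cubes suffice. In `minimaxRisk_ge_sparse` the left factor copies rows of `B`, and the bits are
about `s` entries of `B`. In `minimaxRisk_ge_dense` the right factor copies columns of `A`, and the
bits are the `r n₁ n₃` entries of `A`. Both cover at least a proportion `Δ` of the positions, and
the larger of `s` and `r n₁ n₃` is at least half their sum. -/

namespace SparseNTF

/-! ### Laplace densities and their Hellinger affinity -/

/-- The density of the centred Laplace distribution. -/
noncomputable def laplacePDF (τ x : ℝ) : ℝ := 1 / (2 * τ) * Real.exp (-|x| / τ)

lemma laplacePDF_pos {τ : ℝ} (hτ : 0 < τ) (x : ℝ) : 0 < laplacePDF τ x := by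
  unfold laplacePDF; positivity

lemma continuous_laplacePDF (τ : ℝ) : Continuous (laplacePDF τ) := by
  unfold laplacePDF; fun_prop

lemma integrable_exp_neg_abs : Integrable (fun x : ℝ => Real.exp (-|x|)) := by
  have hI : IntegrableOn (fun x : ℝ => Real.exp (-|x|)) (Set.Ioi 0) :=
    (integrableOn_exp_neg_Ioi 0).congr_fun
      (fun x hx => by simp only [abs_of_pos (Set.mem_Ioi.1 hx)]) measurableSet_Ioi
  have hJ : IntegrableOn (fun x : ℝ => Real.exp (-|x|)) (Set.Iic 0) :=
    integrableOn_Iic_iff_integrableOn_Iio (by finiteness) |>.2 <| by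
      have := hI.comp_neg
      simpa using this
  rw [← integrableOn_univ, ← Set.Iic_union_Ioi (a := (0 : ℝ))]
  exact hJ.union hI

lemma integral_exp_neg_abs : ∫ x : ℝ, Real.exp (-|x|) = 2 := by
  rw [integral_comp_abs (f := fun x => Real.exp (-x)), integral_exp_neg_Ioi_zero, mul_one]

lemma laplacePDF_eq_comp_div {τ : ℝ} (hτ : 0 < τ) (x : ℝ) :
    laplacePDF τ x = 1 / (2 * τ) * Real.exp (-|x / τ|) := by
  rw [laplacePDF, abs_div, abs_of_pos hτ, neg_div]

lemma integrable_laplacePDF {τ : ℝ} (hτ : 0 < τ) : Integrable (laplacePDF τ) := by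
  simp_rw [funext (laplacePDF_eq_comp_div hτ)]
  exact (integrable_exp_neg_abs.comp_div hτ.ne').const_mul _

lemma integral_laplacePDF {τ : ℝ} (hτ : 0 < τ) : ∫ x, laplacePDF τ x = 1 := by
  simp_rw [laplacePDF_eq_comp_div hτ]
  rw [integral_const_mul, Measure.integral_comp_div (fun x => Real.exp (-|x|)) τ,
    integral_exp_neg_abs, abs_of_pos hτ, smul_eq_mul]
  field_simp

/-- The pointwise geometric mean of two Laplace densities with locations `a` and `b`. -/
noncomputable def laplaceGeomMean (τ a b x : ℝ) : ℝ :=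
  √(laplacePDF τ (x - a) * laplacePDF τ (x - b))

lemma continuous_laplaceGeomMean (τ a b : ℝ) : Continuous (laplaceGeomMean τ a b) := by
  have := continuous_laplacePDF τ
  unfold laplaceGeomMean; fun_prop

lemma laplaceGeomMean_nonneg (τ a b x : ℝ) : 0 ≤ laplaceGeomMean τ a b x := Real.sqrt_nonneg _

lemma laplaceGeomMean_le {τ : ℝ} (hτ : 0 < τ) (a b x : ℝ) :
    laplaceGeomMean τ a b x ≤ (laplacePDF τ (x - a) + laplacePDF τ (x - b)) / 2 := by
  have ha := laplacePDF_pos hτ (x - a)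
  have hb := laplacePDF_pos hτ (x - b)
  refine Real.sqrt_le_iff.2 ⟨by positivity, ?_⟩
  nlinarith [sq_nonneg (laplacePDF τ (x - a) - laplacePDF τ (x - b))]

lemma integrable_laplaceGeomMean {τ : ℝ} (hτ : 0 < τ) (a b : ℝ) :
    Integrable (laplaceGeomMean τ a b) := by
  refine Integrable.mono' ((((integrable_laplacePDF hτ).comp_sub_right a).add
    ((integrable_laplacePDF hτ).comp_sub_right b)).div_const 2)
    (continuous_laplaceGeomMean τ a b).aestronglyMeasurable (Filter.Eventually.of_forall fun x => ?_)
  rw [Real.norm_of_nonneg (laplaceGeomMean_nonneg ..)]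
  exact laplaceGeomMean_le hτ a b x

/-- The Hellinger affinity of two Laplace distributions with the same diversity. -/
noncomputable def laplaceAffinity (τ a b : ℝ) : ℝ := ∫ x, laplaceGeomMean τ a b x

lemma laplaceAffinity_nonneg (τ a b : ℝ) : 0 ≤ laplaceAffinity τ a b :=
  integral_nonneg (laplaceGeomMean_nonneg τ a b)

lemma laplaceAffinity_le_one {τ : ℝ} (hτ : 0 < τ) (a b : ℝ) : laplaceAffinity τ a b ≤ 1 := by
  have hi := integrable_laplacePDF hτ
  calc laplaceAffinity τ a b
      ≤ ∫ x, (laplacePDF τ (x - a) + laplacePDF τ (x - b)) / 2 :=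
        integral_mono (integrable_laplaceGeomMean hτ a b)
          (((hi.comp_sub_right a).add (hi.comp_sub_right b)).div_const 2) (laplaceGeomMean_le hτ a b)
    _ = 1 := by
        rw [integral_div, integral_add (hi.comp_sub_right a) (hi.comp_sub_right b),
          integral_sub_right_eq_self (laplacePDF τ), integral_sub_right_eq_self (laplacePDF τ),
          integral_laplacePDF hτ]
        norm_num

lemma laplaceGeomMean_comm (τ a b x : ℝ) : laplaceGeomMean τ a b x = laplaceGeomMean τ b a x := by
  rw [laplaceGeomMean, mul_comm, laplaceGeomMean]

lemma laplaceGeomMean_eq {τ : ℝ} (hτ : 0 < τ) (a b x : ℝ) :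
    laplaceGeomMean τ a b x = 1 / (2 * τ) * Real.exp (-((|x - a| + |x - b|) / 2) / τ) := by
  rw [laplaceGeomMean, Real.sqrt_eq_iff_mul_self_eq (mul_nonneg (laplacePDF_pos hτ _).le
    (laplacePDF_pos hτ _).le) (by positivity), laplacePDF, laplacePDF, mul_mul_mul_comm,
    mul_mul_mul_comm _ _ (1 / (2 * τ)), ← Real.exp_add, ← Real.exp_add]
  congr 2
  ring

/-- Centred at the midpoint, the mean of the two distances is `|x|` outside the interval between the
locations and constant inside. The geometric mean is therefore the Laplace density with its peak cut
flat, and `1 - e⁻ᵘ ≤ u` bounds the height removed. -/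
lemma le_laplaceGeomMean_add {τ : ℝ} (hτ : 0 < τ) {a b : ℝ} (hab : a ≤ b) (x : ℝ) :
    laplacePDF τ x - (Set.Icc (-((b - a) / 2)) ((b - a) / 2)).indicator
      (fun _ => 1 / (2 * τ) * ((b - a) / (2 * τ))) x ≤ laplaceGeomMean τ a b (x + (a + b) / 2) := by
  rw [laplaceGeomMean_eq hτ, laplacePDF, Set.indicator_apply]
  have hτ' : 0 ≤ 1 / (2 * τ) := by positivity
  split_ifs with h
  · have hx : (|x + (a + b) / 2 - a| + |x + (a + b) / 2 - b|) / 2 = (b - a) / 2 := by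
      rw [abs_of_nonneg (by linarith [h.1]), abs_of_nonpos (by linarith [h.2])]; ring
    rw [hx, ← mul_sub]
    refine mul_le_mul_of_nonneg_left ?_ hτ'
    have h1 : Real.exp (-|x| / τ) ≤ 1 :=
      Real.exp_le_one_iff.2 (div_nonpos_of_nonpos_of_nonneg (by simp) hτ.le)
    have h2 := Real.add_one_le_exp (-((b - a) / 2) / τ)
    have h3 : -((b - a) / 2) / τ = -((b - a) / (2 * τ)) := by field_simp
    rw [h3] at h2 ⊢
    linarith
  · have hx : (|x + (a + b) / 2 - a| + |x + (a + b) / 2 - b|) / 2 = |x| := by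
      rcases le_or_gt x 0 with h0 | h0
      · have : x < -((b - a) / 2) := by
          by_contra hc; exact h ⟨by linarith, by linarith⟩
        rw [abs_of_nonpos (by linarith), abs_of_nonpos (by linarith), abs_of_nonpos h0]; ring
      · have : (b - a) / 2 < x := by
          by_contra hc; exact h ⟨by linarith, by linarith⟩
        rw [abs_of_nonneg (by linarith), abs_of_nonneg (by linarith), abs_of_pos h0]; ring
    rw [hx, sub_zero]

/-- The removed peak has width `b - a` and height at most `(b - a)/(4τ²)`, so the loss is quadratic
despite the kink of the density. -/
lemma one_sub_le_laplaceAffinity {τ : ℝ} (hτ : 0 < τ) (a b : ℝ) :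
    1 - (a - b) ^ 2 / (4 * τ ^ 2) ≤ laplaceAffinity τ a b := by
  wlog hab : a ≤ b generalizing a b
  · have := this b a (le_of_not_ge hab)
    rw [laplaceAffinity, show laplaceGeomMean τ a b = laplaceGeomMean τ b a from
      funext (laplaceGeomMean_comm τ a b), ← neg_sub b a, neg_sq]
    exact this
  set S := Set.Icc (-((b - a) / 2)) ((b - a) / 2)
  set c := 1 / (2 * τ) * ((b - a) / (2 * τ)) with hc
  have hind : Integrable (S.indicator (fun _ => c)) :=
    (integrable_indicator_iff measurableSet_Icc).2
      (integrableOn_const (by simp))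
  rw [laplaceAffinity, ← integral_add_right_eq_self (laplaceGeomMean τ a b) ((a + b) / 2)]
  refine le_trans (le_of_eq ?_) (integral_mono ((integrable_laplacePDF hτ).sub hind)
    ((integrable_laplaceGeomMean hτ a b).comp_add_right _) (le_laplaceGeomMean_add hτ hab))
  simp only [Pi.sub_apply]
  rw [integral_sub (integrable_laplacePDF hτ) hind, integral_laplacePDF hτ,
    integral_indicator measurableSet_Icc, setIntegral_const, Real.volume_real_Icc_of_le
    (by linarith), smul_eq_mul, hc]
  field_simp
  ring

/-! ### Product structure of the noise -/

lemma one_sub_sum_le_prod {ι : Type*} (s : Finset ι) (f g : ι → ℝ)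
    (h0 : ∀ i ∈ s, 0 ≤ g i) (h1 : ∀ i ∈ s, g i ≤ 1) (hfg : ∀ i ∈ s, 1 - f i ≤ g i) :
    1 - ∑ i ∈ s, f i ≤ ∏ i ∈ s, g i := by
  classical
  induction s using Finset.induction_on with
  | empty => simp
  | insert i s hi ih =>
    rw [Finset.sum_insert hi, Finset.prod_insert hi]
    have ih' := ih (fun j hj => h0 j (Finset.mem_insert_of_mem hj))
      (fun j hj => h1 j (Finset.mem_insert_of_mem hj))
      (fun j hj => hfg j (Finset.mem_insert_of_mem hj))
    have hp : ∏ j ∈ s, g j ≤ 1 := Finset.prod_le_one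
      (fun j hj => h0 j (Finset.mem_insert_of_mem hj))
      (fun j hj => h1 j (Finset.mem_insert_of_mem hj))
    have hi1 := h1 i (Finset.mem_insert_self i s)
    have hi2 := hfg i (Finset.mem_insert_self i s)
    -- The hint expands to `g i + ∏ g - 1 ≤ g i * ∏ g`: losses from `1` are subadditive.
    nlinarith [mul_nonneg (sub_nonneg.2 hi1) (sub_nonneg.2 hp)]

lemma lintegral_prod_eq_ofReal_prod {ι : Type*} [Fintype ι] (f : ι → ℝ → ℝ)
    (hf : ∀ i, Integrable (f i)) (h0 : ∀ i x, 0 ≤ f i x) :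
    ∫⁻ x : ι → ℝ, ENNReal.ofReal (∏ i, f i (x i)) = ENNReal.ofReal (∏ i, ∫ x, f i x) := by
  rw [← integral_fintype_prod_volume_eq_prod]
  exact (ofReal_integral_eq_lintegral_ofReal (Integrable.fintype_prod hf)
    (Filter.Eventually.of_forall fun x => Finset.prod_nonneg fun i _ => h0 i _)).symm

lemma laplaceMeasure_zero_apply {τ : ℝ} (hτ : 0 < τ) {s : Set ℝ} (hs : MeasurableSet s) :
    laplaceMeasure 0 τ s = ENNReal.ofReal (∫ x, s.indicator (laplacePDF τ) x) := by
  rw [laplaceMeasure, withDensity_apply _ hs, integral_indicator hs,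
    ofReal_integral_eq_lintegral_ofReal (integrable_laplacePDF hτ).integrableOn
      (Filter.Eventually.of_forall fun x => (laplacePDF_pos hτ x).le)]
  simp [laplacePDF]

instance (τ : ℝ) : SigmaFinite (laplaceMeasure 0 τ) := by
  unfold laplaceMeasure; infer_instance

lemma noiseLaw_eq_withDensity (n₁ n₂ n₃ : ℕ) {τ : ℝ} (hτ : 0 < τ) :
    noiseLaw n₁ n₂ n₃ τ =
      volume.withDensity fun y => ENNReal.ofReal (∏ p, laplacePDF τ (y p)) := by
  refine Measure.pi_eq fun s hs => ?_
  rw [withDensity_apply _ (.univ_pi hs), ← lintegral_indicator (.univ_pi hs)]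
  simp_rw [fun p => laplaceMeasure_zero_apply hτ (hs p)]
  rw [← ENNReal.ofReal_prod_of_nonneg fun p _ => integral_nonneg fun x =>
    Set.indicator_nonneg (fun x _ => (laplacePDF_pos hτ x).le) x]
  rw [← lintegral_prod_eq_ofReal_prod _ (fun p => (integrable_laplacePDF hτ).indicator (hs p))
    fun p x => Set.indicator_nonneg (fun x _ => (laplacePDF_pos hτ x).le) x]
  refine lintegral_congr fun y => ?_
  by_cases hy : y ∈ Set.univ.pi s
  · rw [Set.indicator_of_mem hy]
    congr 1
    exact Finset.prod_congr rfl fun p _ =>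
      (Set.indicator_of_mem (hy p (Set.mem_univ p)) (laplacePDF τ)).symm
  · rw [Set.indicator_of_notMem hy]
    obtain ⟨p, hp⟩ : ∃ p, y p ∉ s p := by simpa [Set.mem_pi] using hy
    rw [Finset.prod_eq_zero (Finset.mem_univ p) (Set.indicator_of_notMem hp _), ENNReal.ofReal_zero]

lemma continuous_prod_laplacePDF {n₁ n₂ n₃ : ℕ} (τ : ℝ) (μ : Idx n₁ n₂ n₃ → ℝ) :
    Continuous fun y : Idx n₁ n₂ n₃ → ℝ => ∏ p, laplacePDF τ (y p - μ p) :=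
  continuous_finsetProd _ fun p _ => (continuous_laplacePDF τ).comp (by fun_prop)

/-- Translation moves the signal from the argument of `G` into the density, so that two hypotheses
are compared through the same function of the data. -/
lemma lintegral_noiseLaw_add {n₁ n₂ n₃ : ℕ} {τ : ℝ} (hτ : 0 < τ) (μ : Idx n₁ n₂ n₃ → ℝ)
    {G : (Idx n₁ n₂ n₃ → ℝ) → ℝ≥0∞} (hG : Measurable G) :
    ∫⁻ ε, G (μ + ε) ∂noiseLaw n₁ n₂ n₃ τ =
      ∫⁻ y, ENNReal.ofReal (∏ p, laplacePDF τ (y p - μ p)) * G y := by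
  have hm := (continuous_prod_laplacePDF τ (0 : Idx n₁ n₂ n₃ → ℝ)).measurable.ennreal_ofReal
  simp only [Pi.zero_apply, sub_zero] at hm
  have hGμ : Measurable fun ε => G (μ + ε) := hG.comp (measurable_const_add μ)
  rw [noiseLaw_eq_withDensity n₁ n₂ n₃ hτ, lintegral_withDensity_eq_lintegral_mul _ hm hGμ,
    ← lintegral_sub_right_eq_self _ μ]
  simp

/-! ### Le Cam's two-point inequality -/

/-- A pointwise form of Le Cam's two-point inequality for the squared loss. -/
lemma sqrt_mul_le_two_point {P Q : ℝ} (hP : 0 < P) (hQ : 0 < Q) (t u v : ℝ) :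
    (u - v) ^ 2 * √(P * Q) ≤ P * (t - u) ^ 2 + Q * (t - v) ^ 2 + (u - v) ^ 2 / 4 * (P + Q) := by
  obtain ⟨w, hw⟩ : ∃ w, w = √(P * Q) := ⟨_, rfl⟩
  have hw2 : w ^ 2 = P * Q := by rw [hw, Real.sq_sqrt (by positivity)]
  rw [← hw]
  refine le_of_mul_le_mul_right ?_ (add_pos hP hQ)
  -- After multiplication by `P + Q`, the difference of the two sides is exactly `(P(t-u) + Q(t-v))²
  -- + (u-v)²(w - (P+Q)/2)²`, by `w² = PQ`.
  have h1 := sq_nonneg (P * (t - u) + Q * (t - v))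
  have h2 := mul_nonneg (sq_nonneg (u - v)) (sq_nonneg (w - (P + Q) / 2))
  have h3 : (u - v) ^ 2 * w ^ 2 = (u - v) ^ 2 * (P * Q) := by rw [hw2]
  nlinarith

/-- Le Cam's two-point inequality for two Laplace location models. -/
lemma two_point_le {n₁ n₂ n₃ : ℕ} {τ : ℝ} (hτ : 0 < τ) (μ ν : Idx n₁ n₂ n₃ → ℝ)
    {t : (Idx n₁ n₂ n₃ → ℝ) → ℝ} (ht : Measurable t) (u v : ℝ) :
    ENNReal.ofReal ((u - v) ^ 2 / 2) ≤
      ∫⁻ ε, ENNReal.ofReal ((t (μ + ε) - u) ^ 2) ∂noiseLaw n₁ n₂ n₃ τ +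
      ∫⁻ ε, ENNReal.ofReal ((t (ν + ε) - v) ^ 2) ∂noiseLaw n₁ n₂ n₃ τ +
      ENNReal.ofReal ((u - v) ^ 2 * ∑ p, (μ p - ν p) ^ 2 / (4 * τ ^ 2)) := by
  have hmt : ∀ w, Measurable fun y => ENNReal.ofReal ((t y - w) ^ 2) := fun w =>
    ((ht.sub_const w).pow_const 2).ennreal_ofReal
  rw [lintegral_noiseLaw_add hτ μ (hmt u), lintegral_noiseLaw_add hτ ν (hmt v)]
  set P : (Idx n₁ n₂ n₃ → ℝ) → ℝ := fun y => ∏ p, laplacePDF τ (y p - μ p) with hP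
  set Q : (Idx n₁ n₂ n₃ → ℝ) → ℝ := fun y => ∏ p, laplacePDF τ (y p - ν p) with hQ
  have hP0 : ∀ y, 0 < P y := fun y => Finset.prod_pos fun p _ => laplacePDF_pos hτ _
  have hQ0 : ∀ y, 0 < Q y := fun y => Finset.prod_pos fun p _ => laplacePDF_pos hτ _
  have hPm : Measurable fun y => ENNReal.ofReal (P y) :=
    (continuous_prod_laplacePDF τ μ).measurable.ennreal_ofReal
  have hQm : Measurable fun y => ENNReal.ofReal (Q y) :=
    (continuous_prod_laplacePDF τ ν).measurable.ennreal_ofReal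
  have hone : ∀ κ : Idx n₁ n₂ n₃ → ℝ,
      ∫⁻ y : Idx n₁ n₂ n₃ → ℝ, ENNReal.ofReal (∏ p, laplacePDF τ (y p - κ p)) = 1 := fun κ => by
    rw [lintegral_prod_eq_ofReal_prod (fun p x => laplacePDF τ (x - κ p))
      (fun p => (integrable_laplacePDF hτ).comp_sub_right _) fun p x => (laplacePDF_pos hτ _).le]
    simp [fun a => integral_sub_right_eq_self (laplacePDF τ) (μ := volume) a,
      integral_laplacePDF hτ]
  have hsqrt : ∀ y, √(P y * Q y) = ∏ p, laplaceGeomMean τ (μ p) (ν p) (y p) := fun y => by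
    rw [hP, hQ]
    simp only [laplaceGeomMean]
    rw [← Finset.prod_mul_distrib, Real.sqrt_eq_iff_mul_self_eq
      (Finset.prod_nonneg fun p _ => mul_nonneg (laplacePDF_pos hτ _).le (laplacePDF_pos hτ _).le)
      (Finset.prod_nonneg fun p _ => Real.sqrt_nonneg _), ← Finset.prod_mul_distrib]
    exact Finset.prod_congr rfl fun p _ => (Real.mul_self_sqrt
      (mul_nonneg (laplacePDF_pos hτ _).le (laplacePDF_pos hτ _).le)).symm
  set d := (u - v) ^ 2 with hd
  have hd0 : 0 ≤ d := sq_nonneg _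
  -- The pointwise inequality is integrated: `√(PQ)` factors into affinities, and `P`, `Q` have mass
  -- one, which leaves `2 · d/4 = d/2`.
  have key : ENNReal.ofReal (d * ∏ p, laplaceAffinity τ (μ p) (ν p)) ≤
      (∫⁻ y, ENNReal.ofReal (P y) * ENNReal.ofReal ((t y - u) ^ 2)) +
      (∫⁻ y, ENNReal.ofReal (Q y) * ENNReal.ofReal ((t y - v) ^ 2)) + ENNReal.ofReal (d / 2) := by
    calc ENNReal.ofReal (d * ∏ p, laplaceAffinity τ (μ p) (ν p))
        = ∫⁻ y, ENNReal.ofReal d * ENNReal.ofReal (√(P y * Q y)) := by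
          simp_rw [hsqrt]
          rw [lintegral_const_mul' _ _ ENNReal.ofReal_ne_top, lintegral_prod_eq_ofReal_prod _
            (fun p => integrable_laplaceGeomMean hτ _ _) fun p => laplaceGeomMean_nonneg _ _ _,
            ENNReal.ofReal_mul hd0]
          rfl
      _ ≤ ∫⁻ y, (ENNReal.ofReal (P y) * ENNReal.ofReal ((t y - u) ^ 2) +
            ENNReal.ofReal (Q y) * ENNReal.ofReal ((t y - v) ^ 2) +
            ENNReal.ofReal (d / 4) * (ENNReal.ofReal (P y) + ENNReal.ofReal (Q y))) := by
          refine lintegral_mono fun y => ?_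
          have h1 := (hP0 y).le
          have h2 := (hQ0 y).le
          rw [← ENNReal.ofReal_mul hd0, ← ENNReal.ofReal_mul h1, ← ENNReal.ofReal_mul h2,
            ← ENNReal.ofReal_add h1 h2, ← ENNReal.ofReal_mul (by positivity),
            ← ENNReal.ofReal_add (by positivity) (by positivity),
            ← ENNReal.ofReal_add (by positivity) (by positivity)]
          exact ENNReal.ofReal_le_ofReal (sqrt_mul_le_two_point (hP0 y) (hQ0 y) _ _ _)
      _ = _ := by
          have hPQm : Measurable fun y =>
              ENNReal.ofReal (d / 4) * (ENNReal.ofReal (P y) + ENNReal.ofReal (Q y)) :=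
            (hPm.add hQm).const_mul _
          have hQvm : Measurable fun y => ENNReal.ofReal (Q y) * ENNReal.ofReal ((t y - v) ^ 2) :=
            hQm.mul (hmt v)
          rw [lintegral_add_right _ hPQm, lintegral_add_right _ hQvm,
            lintegral_const_mul' _ _ ENNReal.ofReal_ne_top,
            lintegral_add_left hPm, hone μ, hone ν, one_add_one_eq_two,
            ← ENNReal.ofReal_ofNat 2, ← ENNReal.ofReal_mul (by positivity)]
          congr 2
          ring
  have hprod := one_sub_sum_le_prod Finset.univ (fun p => (μ p - ν p) ^ 2 / (4 * τ ^ 2))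
    (fun p => laplaceAffinity τ (μ p) (ν p)) (fun p _ => laplaceAffinity_nonneg _ _ _)
    (fun p _ => laplaceAffinity_le_one hτ _ _) fun p _ => one_sub_le_laplaceAffinity hτ _ _
  set D := ∑ p, (μ p - ν p) ^ 2 / (4 * τ ^ 2) with hD
  have hD0 : 0 ≤ D := Finset.sum_nonneg fun p _ => by positivity
  -- Adding `d/2` to both sides replaces a subtraction in `[0, ∞]`.
  refine (ENNReal.add_le_add_iff_right (a := ENNReal.ofReal (d / 2)) ENNReal.ofReal_ne_top).1 ?_
  calc ENNReal.ofReal (d / 2) + ENNReal.ofReal (d / 2) = ENNReal.ofReal d := by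
        rw [← ENNReal.ofReal_add (by positivity) (by positivity), add_halves]
    _ ≤ ENNReal.ofReal (d * ∏ p, laplaceAffinity τ (μ p) (ν p) + d * D) :=
        ENNReal.ofReal_le_ofReal (by nlinarith [mul_le_mul_of_nonneg_left hprod hd0])
    _ ≤ ENNReal.ofReal (d * ∏ p, laplaceAffinity τ (μ p) (ν p)) + ENNReal.ofReal (d * D) :=
        ENNReal.ofReal_add_le
    _ ≤ _ := by
        rw [add_right_comm _ (ENNReal.ofReal (d * D))]
        gcongr

/-! ### Random sampling and the risk at one position -/

lemma setBernoulli_univ_mem {ι : Type*} [Countable ι] (γ : unitInterval) (i : ι) :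
    setBernoulli (Set.univ : Set ι) γ {Ω | i ∈ Ω} = ENNReal.ofReal γ := by
  rw [setBernoulli_apply']
  have h : ((fun p : ι → Prop => {i | p i}) ⁻¹' {Ω | i ∈ Ω}) = 
      Function.eval i ⁻¹' ({True} : Set Prop) := by
    ext; simp
  rw [h, (measurePreserving_eval_infinitePi _ i).measure_preimage
    (MeasurableSet.of_discrete).nullMeasurableSet]
  simp only [ENNReal.ofReal_eq_coe_nnreal γ.2.1]
  simp
  rfl

variable {n₁ n₂ n₃ : ℕ}

/-- The expected squared error of an estimator at a single position. -/
noncomputable def entryRisk (γ : unitInterval) (τ : ℝ) (T : Estimator n₁ n₂ n₃)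
    (X : Tensor n₁ n₂ n₃) (p : Idx n₁ n₂ n₃) : ℝ≥0∞ :=
  ∫⁻ Ω, ∫⁻ ε, ENNReal.ofReal
    ((T.toFun Ω (observe X Ω ε) p.1 p.2.1 p.2.2 - X p.1 p.2.1 p.2.2) ^ 2)
    ∂noiseLaw n₁ n₂ n₃ τ ∂setBernoulli Set.univ γ

lemma frobSq_eq_sum (X : Tensor n₁ n₂ n₃) : frobSq X = ∑ p : Idx n₁ n₂ n₃, X p.1 p.2.1 p.2.2 ^ 2 := by
  simp [frobSq, Fintype.sum_prod_type]

/-- Superadditivity of the lower integral needs no measurability, so none has to be checked for the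
error of the estimator. -/
lemma sum_lintegral_le {α ι : Type*} [MeasurableSpace α] (μ : Measure α) (s : Finset ι)
    (f : ι → α → ℝ≥0∞) : ∑ i ∈ s, ∫⁻ a, f i a ∂μ ≤ ∫⁻ a, ∑ i ∈ s, f i a ∂μ := by
  classical
  induction s using Finset.induction_on with
  | empty => simp
  | insert i s hi ih =>
    simp_rw [Finset.sum_insert hi]
    exact (add_le_add_right ih _).trans (le_lintegral_add _ _)

lemma sum_entryRisk_le_risk (γ : unitInterval) (τ : ℝ) (T : Estimator n₁ n₂ n₃)
    (X : Tensor n₁ n₂ n₃) (S : Finset (Idx n₁ n₂ n₃)) :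
    (∑ p ∈ S, entryRisk γ τ T X p) / ((n₁ * n₂ * n₃ : ℕ) : ℝ≥0∞) ≤ risk γ τ T X := by
  refine ENNReal.div_le_div_right ?_ _
  refine (sum_lintegral_le _ _ _).trans (lintegral_mono fun Ω => ?_)
  refine (sum_lintegral_le _ _ _).trans (lintegral_mono fun ε => ?_)
  rw [← ENNReal.ofReal_sum_of_nonneg fun p _ => sq_nonneg _, frobSq_eq_sum]
  exact ENNReal.ofReal_le_ofReal
    (Finset.sum_le_sum_of_subset_of_nonneg (Finset.subset_univ S) fun p _ _ => sq_nonneg _)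

/-- For fixed `Ω`, both signals are set to `0` off `Ω`. The estimator does not see those
coordinates, and they no longer contribute to the distance. -/
lemma two_point_observe_le {τ : ℝ} (hτ : 0 < τ) (T : Estimator n₁ n₂ n₃) (X Y : Tensor n₁ n₂ n₃)
    (p : Idx n₁ n₂ n₃) (Ω : Set (Idx n₁ n₂ n₃)) :
    ENNReal.ofReal ((X p.1 p.2.1 p.2.2 - Y p.1 p.2.1 p.2.2) ^ 2 / 2) ≤
      (∫⁻ ε, ENNReal.ofReal
        ((T.toFun Ω (observe X Ω ε) p.1 p.2.1 p.2.2 - X p.1 p.2.1 p.2.2) ^ 2)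
        ∂noiseLaw n₁ n₂ n₃ τ) +
      (∫⁻ ε, ENNReal.ofReal
        ((T.toFun Ω (observe Y Ω ε) p.1 p.2.1 p.2.2 - Y p.1 p.2.1 p.2.2) ^ 2)
        ∂noiseLaw n₁ n₂ n₃ τ) +
      ∑ q : Idx n₁ n₂ n₃, {Ω : Set (Idx n₁ n₂ n₃) | q ∈ Ω}.indicator
        (fun _ => ENNReal.ofReal ((X p.1 p.2.1 p.2.2 - Y p.1 p.2.1 p.2.2) ^ 2 *
          ((X q.1 q.2.1 q.2.2 - Y q.1 q.2.1 q.2.2) ^ 2 / (4 * τ ^ 2)))) Ω := by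
  classical
  let mask : Tensor n₁ n₂ n₃ → Idx n₁ n₂ n₃ → ℝ :=
    fun Z q => if q ∈ Ω then Z q.1 q.2.1 q.2.2 else 0
  have hmask : ∀ Z ε, observe Z Ω ε = fun q : Ω => (mask Z + ε) q := fun Z ε => by
    funext q
    simp [mask, observe]
  have ht : Measurable fun y : Idx n₁ n₂ n₃ → ℝ =>
      T.toFun Ω (fun q : Ω => y q) p.1 p.2.1 p.2.2 := by
    have h := (T.measurable_toFun Ω).comp
      (measurable_pi_lambda (fun (y : Idx n₁ n₂ n₃ → ℝ) (q : Ω) => y q) fun q =>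
        measurable_pi_apply _)
    exact (measurable_pi_apply p.2.2).comp ((measurable_pi_apply p.2.1).comp
      ((measurable_pi_apply p.1).comp h))
  have h := two_point_le hτ (mask X) (mask Y) ht (X p.1 p.2.1 p.2.2) (Y p.1 p.2.1 p.2.2)
  simp_rw [hmask]
  refine h.trans (add_le_add_right (le_of_eq ?_) _)
  rw [Finset.mul_sum, ENNReal.ofReal_sum_of_nonneg fun q _ => by positivity]
  refine Finset.sum_congr rfl fun q _ => ?_
  by_cases hq : q ∈ Ω <;> simp [mask, hq]

/-- The information term is linear in the indicators of `q ∈ Ω`, so averaging over `Ω` uses only the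
marginal probability `γ`. -/
lemma two_point_entryRisk_le {τ : ℝ} (hτ : 0 < τ) (γ : unitInterval) (T : Estimator n₁ n₂ n₃)
    (X Y : Tensor n₁ n₂ n₃) (p : Idx n₁ n₂ n₃) :
    ENNReal.ofReal ((X p.1 p.2.1 p.2.2 - Y p.1 p.2.1 p.2.2) ^ 2 / 2) ≤
      entryRisk γ τ T X p + entryRisk γ τ T Y p +
      ENNReal.ofReal ((X p.1 p.2.1 p.2.2 - Y p.1 p.2.1 p.2.2) ^ 2 *
        (γ * ∑ q : Idx n₁ n₂ n₃, (X q.1 q.2.1 q.2.2 - Y q.1 q.2.1 q.2.2) ^ 2 / (4 * τ ^ 2))) := by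
  have hγ := γ.2.1
  have h := lintegral_mono (μ := setBernoulli Set.univ γ) (two_point_observe_le hτ T X Y p)
  rw [lintegral_const, measure_univ, mul_one, lintegral_add_left .of_discrete,
    lintegral_add_left .of_discrete, lintegral_finsetSum _ fun q _ => .of_discrete] at h
  refine h.trans (add_le_add_right (le_of_eq ?_) _)
  rw [Finset.mul_sum, Finset.mul_sum, ENNReal.ofReal_sum_of_nonneg fun q _ => by positivity]
  refine Finset.sum_congr rfl fun q _ => ?_
  rw [lintegral_indicator_const .of_discrete, setBernoulli_univ_mem,
    ← ENNReal.ofReal_mul (by positivity)]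
  congr 1
  ring

/-! ### Assouad's hypercube bound -/

/-- A lower bound for the maximal risk over a hypercube of tensors: if the tensor `X ω` has the
entry `β` or `0` at a position `p ∈ S` according to the bit `ω (c p)`, vanishes off `S`, and each
bit is observed not too often, then a fraction of the error `#S * β ^ 2` is unavoidable. -/
lemma hypercube_lower_bound {κ : Type*} [Fintype κ] [DecidableEq κ] {τ : ℝ} (hτ : 0 < τ)
    (γ : unitInterval) (T : Estimator n₁ n₂ n₃) (U : Set (Tensor n₁ n₂ n₃)) (β M : ℝ)
    (S : Finset (Idx n₁ n₂ n₃)) (c : Idx n₁ n₂ n₃ → κ) (X : (κ → Bool) → Tensor n₁ n₂ n₃)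
    (hXU : ∀ ω, X ω ∈ U)
    (hX : ∀ ω p, X ω p.1 p.2.1 p.2.2 = if p ∈ S ∧ ω (c p) then β else 0)
    (hM : ∀ a, (({p ∈ S | c p = a} : Finset _).card : ℝ) ≤ M) (hβ : γ * M * β ^ 2 ≤ τ ^ 2) :
    ENNReal.ofReal (S.card * (β ^ 2 / 8)) / ((n₁ * n₂ * n₃ : ℕ) : ℝ≥0∞) ≤
      ⨆ Z ∈ U, risk γ τ T Z := by
  have hγ := γ.2.1
  set flip : κ → (κ → Bool) → κ → Bool := fun a ω => Function.update ω a (!ω a) with hflip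
  have hinv : ∀ a, Function.Involutive (flip a) := fun a ω => by
    funext d
    by_cases hd : d = a
    · subst hd; simp [hflip]
    · simp [hflip, hd]
  have hdiff : ∀ ω a q, (X ω q.1 q.2.1 q.2.2 - X (flip a ω) q.1 q.2.1 q.2.2) ^ 2 =
      if q ∈ S ∧ c q = a then β ^ 2 else 0 := fun ω a q => by
    rw [hX, hX]
    by_cases hq : q ∈ S
    · by_cases hc : c q = a
      · subst hc
        cases h : ω (c q) <;> simp [hflip, hq, h]
      · simp [hflip, hq, hc]
    · simp [hq]
  -- Flipping the bit of `p` changes only its fibre in `S`, of size at most `M`. The information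
  -- term is then at most `β²/4`, leaving `β²/2 - β²/4`.
  have hpair : ∀ p ∈ S, ∀ ω, ENNReal.ofReal (β ^ 2 / 4) ≤
      entryRisk γ τ T (X ω) p + entryRisk γ τ T (X (flip (c p) ω)) p := fun p hp ω => by
    have h := two_point_entryRisk_le hτ γ T (X ω) (X (flip (c p) ω)) p
    simp only [hdiff, hp, true_and, if_true] at h
    rw [← Finset.sum_div, ← Finset.sum_filter, ← Finset.filter_filter, Finset.sum_const,
      Finset.filter_univ_mem, nsmul_eq_mul] at h
    refine (ENNReal.add_le_add_iff_right (a := ENNReal.ofReal (β ^ 2 / 4)) ENNReal.ofReal_ne_top).1 ?_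
    rw [← ENNReal.ofReal_add (by positivity) (by positivity)]
    refine le_trans (le_of_eq ?_) (h.trans (add_le_add_right (ENNReal.ofReal_le_ofReal ?_) _))
    · congr 1; ring
    · have h1 : (γ : ℝ) * (({q ∈ S | c q = c p} : Finset _).card * β ^ 2 / (4 * τ ^ 2)) ≤ 1 / 4 := by
        have h2 : (γ : ℝ) * ({q ∈ S | c q = c p} : Finset _).card * β ^ 2 ≤ τ ^ 2 := by
          refine le_trans ?_ hβ
          gcongr
          exact hM _
        rw [← mul_div_assoc, ← mul_assoc, div_le_iff₀ (by positivity)]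
        linarith
      have := mul_le_mul_of_nonneg_left h1 (sq_nonneg β)
      linarith
  -- The flip is a bijection of the cube, so both summands of `hpair` have the same total, and the
  -- average is at least `β²/8`.
  have hcube : ∀ p ∈ S, (Fintype.card (κ → Bool) : ℝ≥0∞) * ENNReal.ofReal (β ^ 2 / 8) ≤
      ∑ ω, entryRisk γ τ T (X ω) p := fun p hp => by
    have h := Finset.sum_le_sum fun ω (_ : ω ∈ Finset.univ) => hpair p hp ω
    rw [Finset.sum_const, Finset.sum_add_distrib,
      (hinv (c p)).bijective.sum_comp fun ω => entryRisk γ τ T (X ω) p, ← two_mul, nsmul_eq_mul,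
      Finset.card_univ, show β ^ 2 / 4 = 2 * (β ^ 2 / 8) by ring,
      ENNReal.ofReal_mul zero_le_two, mul_left_comm, ENNReal.ofReal_ofNat] at h
    exact (ENNReal.mul_le_mul_iff_right two_ne_zero ENNReal.ofNat_ne_top).1 h
  -- The supremum dominates the average over the cube.
  have hsum : (Fintype.card (κ → Bool) : ℝ≥0∞) *
      (ENNReal.ofReal (S.card * (β ^ 2 / 8)) / ((n₁ * n₂ * n₃ : ℕ) : ℝ≥0∞)) ≤
      Fintype.card (κ → Bool) * ⨆ Z ∈ U, risk γ τ T Z := by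
    calc (Fintype.card (κ → Bool) : ℝ≥0∞) *
          (ENNReal.ofReal (S.card * (β ^ 2 / 8)) / ((n₁ * n₂ * n₃ : ℕ) : ℝ≥0∞))
        = (∑ p ∈ S, (Fintype.card (κ → Bool) : ℝ≥0∞) * ENNReal.ofReal (β ^ 2 / 8)) /
            ((n₁ * n₂ * n₃ : ℕ) : ℝ≥0∞) := by
          rw [Finset.sum_const, nsmul_eq_mul, ENNReal.ofReal_mul (by positivity),
            ENNReal.ofReal_natCast, mul_left_comm, mul_div_assoc, mul_div_assoc, mul_div_assoc,
            mul_left_comm]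
      _ ≤ (∑ p ∈ S, ∑ ω, entryRisk γ τ T (X ω) p) / ((n₁ * n₂ * n₃ : ℕ) : ℝ≥0∞) :=
          ENNReal.div_le_div_right (Finset.sum_le_sum hcube) _
      _ = ∑ ω, (∑ p ∈ S, entryRisk γ τ T (X ω) p) / ((n₁ * n₂ * n₃ : ℕ) : ℝ≥0∞) := by
          rw [Finset.sum_comm]; simp_rw [div_eq_mul_inv, Finset.sum_mul]
      _ ≤ ∑ _ω : κ → Bool, ⨆ Z ∈ U, risk γ τ T Z := Finset.sum_le_sum fun ω _ =>
          (sum_entryRisk_le_risk γ τ T (X ω) S).trans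
            (le_iSup₂ (f := fun Z (_ : Z ∈ U) => risk γ τ T Z) (X ω) (hXU ω))
      _ = _ := by rw [Finset.sum_const, nsmul_eq_mul, Finset.card_univ]
  exact (ENNReal.mul_le_mul_iff_right (by simp) (by simp)).1 hsum

/-- The largest amplitude allowed in `hypercube_lower_bound` gives a bound by the minimum of two
terms. -/
lemma exists_amplitude {γ M b τ : ℝ} (hγ : 0 < γ) (hM : 0 < M) (hb : 0 ≤ b) :
    ∃ β, 0 ≤ β ∧ β ≤ b ∧ γ * M * β ^ 2 ≤ τ ^ 2 ∧ β ^ 2 = min (b ^ 2) (τ ^ 2 / (γ * M)) := by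
  have h0 : 0 ≤ min (b ^ 2) (τ ^ 2 / (γ * M)) := le_min (by positivity) (by positivity)
  refine ⟨√(min (b ^ 2) (τ ^ 2 / (γ * M))), Real.sqrt_nonneg _, ?_, ?_, Real.sq_sqrt h0⟩
  · exact Real.sqrt_le_iff.2 ⟨hb, min_le_left _ _⟩
  · rw [Real.sq_sqrt h0, ← le_div_iff₀' (by positivity)]
    exact min_le_right _ _

/-! ### The two hypercubes inside the class -/

lemma tenProd_apply {n₁ n₂ n₃ n₄ : ℕ} (A : Tensor n₁ n₂ n₃) (B : Tensor n₂ n₄ n₃)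
    (i : Fin n₁) (j : Fin n₄) (k : Fin n₃) :
    tenProd A B i j k = ∑ l, ∑ p, A i p (k - l) * B p j l := by
  simp [tenProd, fold, circ, unfold, Matrix.mul_apply, Fintype.sum_prod_type]

/-- A product whose left factor is supported on the first frontal slice. -/
lemma tenProd_slice_left {n₁ n₂ n₃ n₄ : ℕ} [NeZero n₃] (A : Fin n₁ → Fin n₂) (B : Tensor n₂ n₄ n₃)
    (i : Fin n₁) (j : Fin n₄) (k : Fin n₃) :
    tenProd (fun i p k => if p = A i ∧ k = 0 then 1 else 0) B i j k = B (A i) j k := by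
  rw [tenProd_apply, Finset.sum_eq_single k, Finset.sum_eq_single (A i)] <;>
    simp +contextual [sub_eq_zero, eq_comm]

/-- A product whose right factor is supported on the first frontal slice. -/
lemma tenProd_slice_right {n₁ n₂ n₃ n₄ : ℕ} [NeZero n₃] (A : Tensor n₁ n₂ n₃)
    (σ : Fin n₄ → Fin n₂) (v : Fin n₄ → ℝ) (i : Fin n₁) (j : Fin n₄) (k : Fin n₃) :
    tenProd A (fun p j k => if p = σ j ∧ k = 0 then v j else 0) i j k = A i (σ j) k * v j := by
  rw [tenProd_apply, Finset.sum_eq_single 0, Finset.sum_eq_single (σ j)] <;>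
    simp +contextual

/-- A residue class has at most `N / r + 1` members below `N`, and `r ≤ N` absorbs the `1` into the
factor `2`. -/
lemma card_filter_mod_le {N r : ℕ} (hr : 0 < r) (hrN : r ≤ N) (v : ℕ) :
    ((((Finset.range N).filter fun i => i % r = v % r).card : ℕ) : ℝ) ≤ 2 * N / r := by
  have h : ((Finset.range N).filter fun i => i % r = v % r).card ≤ N / r + 1 := by
    have h := Nat.count_modEq_card N hr v
    rw [Nat.count_eq_card_filter_range] at h
    simp only [Nat.ModEq] at h
    refine (le_of_eq (Eq.trans (by congr!) h)).trans ?_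
    split_ifs <;> omega
  have h1 : ((N / r : ℕ) : ℝ) ≤ N / r := Nat.cast_div_le
  have h2 : (1 : ℝ) ≤ N / r := by
    rw [one_le_div (by positivity)]; exact_mod_cast hrN
  calc _ ≤ ((N / r : ℕ) : ℝ) + 1 := by exact_mod_cast h
    _ ≤ N / r + N / r := by gcongr
    _ = _ := by ring

variable {r s m : ℕ} {b τ : ℝ} {γ : unitInterval}

/-- The form in which the hypercube bound is applied: `a` is a lower
bound for the proportion of positions covered by the cube, `e` one for the number of bits. -/
lemma minimaxRisk_ge_of_hypercube {κ : Type*} [Fintype κ] [DecidableEq κ] (hτ : 0 < τ) (hb : 0 ≤ b)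
    (hn : 0 < n₁ * n₂ * n₃) (hm : 0 < m) (hγ : (γ : ℝ) = (m : ℝ) / ((n₁ : ℝ) * n₂ * n₃)) (M : ℝ)
    (hM0 : 0 < M)
    (S : Finset (Idx n₁ n₂ n₃)) (c : Idx n₁ n₂ n₃ → κ)
    (hM : ∀ d, (({p ∈ S | c p = d} : Finset _).card : ℝ) ≤ M)
    (X : ℝ → (κ → Bool) → Tensor n₁ n₂ n₃)
    (hXU : ∀ β, 0 ≤ β → β ≤ b → ∀ ω, X β ω ∈ candidates n₁ n₂ n₃ r b s)
    (hX : ∀ β, 0 ≤ β → β ≤ b → ∀ ω p,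
      X β ω p.1 p.2.1 p.2.2 = if p ∈ S ∧ ω (c p) then β else 0)
    (a e : ℝ) (ha : a * (n₁ * n₂ * n₃ : ℕ) ≤ S.card) (he : e * M ≤ S.card) :
    ENNReal.ofReal (1 / 8 * min (a * b ^ 2) (τ ^ 2 * (e / m))) ≤
      minimaxRisk n₁ n₂ n₃ r b s γ τ := by
  have hn' : (0 : ℝ) < (n₁ * n₂ * n₃ : ℕ) := by exact_mod_cast hn
  have hm' : (0 : ℝ) < m := by exact_mod_cast hm
  have hγ' : (γ : ℝ) = m / (n₁ * n₂ * n₃ : ℕ) := by rw [hγ]; push_cast; rfl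
  have hγ0 : (0 : ℝ) < γ := by rw [hγ']; positivity
  obtain ⟨β, hβ0, hβb, hβ, hβ2⟩ := exists_amplitude (τ := τ) hγ0 hM0 hb
  refine le_iInf fun T => ?_
  refine le_trans ?_ (hypercube_lower_bound hτ γ T _ β M S c (X β) (hXU β hβ0 hβb)
    (hX β hβ0 hβb) hM hβ)
  rw [← ENNReal.ofReal_natCast (n₁ * n₂ * n₃), ← ENNReal.ofReal_div_of_pos hn']
  refine ENNReal.ofReal_le_ofReal ?_
  rw [le_div_iff₀ hn', hβ2]
  have hc : (0 : ℝ) ≤ S.card := by positivity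
  suffices h : min (a * b ^ 2) (τ ^ 2 * (e / m)) * (n₁ * n₂ * n₃ : ℕ) ≤
      S.card * min (b ^ 2) (τ ^ 2 / (γ * M)) by linarith
  rw [mul_min_of_nonneg _ _ hc, min_mul_of_nonneg _ _ hn'.le]
  refine min_le_min ?_ ?_
  · nlinarith [mul_le_mul_of_nonneg_right ha (sq_nonneg b)]
  -- Since `γ = m/(n₁n₂n₃)`, the second term is `#S/M` times `τ² n₁n₂n₃/m`, and `#S/M ≥ e`.
  · rw [hγ']
    have h := mul_le_mul_of_nonneg_right he
      (show 0 ≤ τ ^ 2 * (n₁ * n₂ * n₃ : ℕ) / (m * M) by positivity)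
    convert h using 1 <;> field_simp

/-- The hypercube obtained by varying the sparse factor. -/
lemma minimaxRisk_ge_sparse (hτ : 0 < τ) (hb : 0 ≤ b) (h₁ : 0 < n₁) (h₂ : 0 < n₂) (h₃ : 0 < n₃)
    (hr : 0 < r) (hr₁ : r ≤ n₁) (hs : s ≤ r * n₂ * n₃) (hm : 0 < m)
    (hγ : (γ : ℝ) = (m : ℝ) / ((n₁ : ℝ) * n₂ * n₃)) :
    ENNReal.ofReal (1 / 8 * min (Delta n₂ n₃ s * b ^ 2) (τ ^ 2 * ((s / 4 : ℝ) / m))) ≤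
      minimaxRisk n₁ n₂ n₃ r b s γ τ := by
  have : NeZero n₃ := ⟨h₃.ne'⟩
  have h23 : 0 < n₂ * n₃ := Nat.mul_pos h₂ h₃
  -- The bits occupy `q` rows of `B`, each on the same set `W` of pairs `(j, k)`: one partly filled
  -- row if `s < n₂n₃`, otherwise as many full rows as `s` allows.
  obtain ⟨q, hq⟩ : ∃ q, q = max 1 (s / (n₂ * n₃)) := ⟨_, rfl⟩
  have hq1 : 1 ≤ q := hq ▸ le_max_left _ _
  have hqr : q ≤ r := by
    rw [hq]
    refine max_le hr (Nat.div_le_of_le_mul ?_)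
    rw [mul_comm, ← mul_assoc]; exact hs
  obtain ⟨W, -, hW⟩ := Finset.exists_subset_card_eq
    (s := (Finset.univ : Finset (Fin n₂ × Fin n₃))) (n := min s (n₂ * n₃)) (by simp)
  have hqW : q * W.card ≤ s := by
    rw [hW, hq]
    rcases le_or_gt s (n₂ * n₃) with h | h
    · rcases h.eq_or_lt with h | h
      · rw [h, Nat.div_self h23]; simp
      · rw [Nat.div_eq_of_lt h]; simp
    · rw [min_eq_right h.le, max_eq_right ((Nat.one_le_div_iff h23).2 h.le)]
      exact Nat.div_mul_le_self _ _
  -- Rounding `s` down to a multiple of `n₂n₃` loses at most a factor `2`, as `s < (q + 1)n₂n₃`.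
  have hsq : s ≤ 2 * (q * W.card) := by
    rw [hW, hq]
    rcases le_or_gt s (n₂ * n₃) with h | h
    · rw [min_eq_left h]
      nlinarith [le_max_left 1 (s / (n₂ * n₃))]
    · have h1 := (Nat.one_le_div_iff h23).2 h.le
      rw [min_eq_right h.le, max_eq_right h1]
      have h2 := Nat.lt_div_mul_add h23 (a := s)
      nlinarith
  let row : Fin n₁ → Fin r := fun i => ⟨i % q, (Nat.mod_lt _ hq1).trans_le hqr⟩
  let S : Finset (Idx n₁ n₂ n₃) := Finset.univ ×ˢ W
  have hS : S.card = n₁ * W.card := by simp [S]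
  -- Bits outside the first `q` rows or outside `W` are idle; their fibres in `S` are empty.
  let B : ℝ → (Fin r × Fin n₂ × Fin n₃ → Bool) → Tensor r n₂ n₃ := fun β ω p j k =>
    if (p.1 < q ∧ (j, k) ∈ W) ∧ ω (p, j, k) then β else 0
  have hX : ∀ β ω (p : Idx n₁ n₂ n₃), tenProd (fun i p k => if p = row i ∧ k = 0 then 1 else 0)
      (B β ω) p.1 p.2.1 p.2.2 = if p ∈ S ∧ ω (row p.1, p.2) then β else 0 := fun β ω p => by
    rw [tenProd_slice_left]
    simp [B, S, row, Nat.mod_lt _ hq1]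
  refine minimaxRisk_ge_of_hypercube hτ hb (by positivity) hm hγ (2 * n₁ / q) (by positivity) S
    (fun p => (row p.1, p.2)) (fun d => ?_)
    (fun β ω => tenProd (fun i p k => if p = row i ∧ k = 0 then 1 else 0) (B β ω))
    (fun β hβ0 hβb ω => ⟨fun i j k => ?_, _, B β ω, rfl, fun i j k => ?_, fun i j k => ?_, ?_⟩)
    (fun β _ _ ω p => hX β ω p) _ _ ?_ ?_
  · refine le_trans ?_ (card_filter_mod_le hq1 (hqr.trans hr₁) d.1)
    have : ({p ∈ S | (row p.1, p.2) = d} : Finset _).card ≤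
        ((Finset.range n₁).filter fun i => i % q = (d.1 : ℕ) % q).card := by
      refine Finset.card_le_card_of_injOn (fun p => (p.1 : ℕ)) ?_ ?_
      · rintro ⟨i, jk⟩ hp
        simp only [Finset.coe_filter, Set.mem_ofPred_eq] at hp
        simp [← hp.2, row]
      · rintro ⟨i, jk⟩ hp ⟨i', jk'⟩ hp' h
        simp only [Finset.coe_filter, Set.mem_ofPred_eq] at hp hp'
        have e1 := congrArg Prod.snd hp.2
        have e2 := congrArg Prod.snd hp'.2
        exact Prod.ext (Fin.ext h) (e1.trans e2.symm)
    exact_mod_cast this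
  · rw [hX β ω (i, j, k)]
    split_ifs <;> simp [hβ0]
  · split_ifs <;> simp
  · dsimp only [B]
    split_ifs <;> simp [hβ0, hβb, hb]
  · refine le_trans ?_ hqW
    have hsub : {p : Idx r n₂ n₃ | B β ω p.1 p.2.1 p.2.2 ≠ 0} ⊆
        ((Finset.univ.filter fun p : Fin r => p.1 < q) ×ˢ W : Finset (Idx r n₂ n₃)) := by
      rintro ⟨p, j, k⟩ hp
      have hp' : (p.1 < q ∧ (j, k) ∈ W) ∧ ω (p, j, k) := by
        by_contra hc
        exact hp (if_neg hc)
      simpa using hp'.1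
    refine (Set.ncard_le_ncard hsub (Finset.finite_toSet _)).trans ?_
    rw [Set.ncard_coe_finset, Finset.card_product]
    refine Nat.mul_le_mul_right _ ?_
    rw [Fin.card_filter_val_lt]
    exact min_le_right _ _
  · rw [hS, hW, Delta]
    push_cast
    have h : (0 : ℝ) < n₂ * n₃ := by exact_mod_cast h23
    refine le_of_eq ?_
    rw [show ((n₁ : ℝ) * n₂ * n₃) = n₁ * (n₂ * n₃) by ring, mul_left_comm,
      min_mul_of_nonneg _ _ h.le, one_mul, div_mul_cancel₀ _ h.ne', min_comm]
  · rw [hS]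
    have h : (s : ℝ) ≤ 2 * (q * W.card) := by exact_mod_cast hsq
    have hq0 : (0 : ℝ) < q := by exact_mod_cast hq1
    push_cast
    rw [mul_div_assoc', div_le_iff₀ hq0]
    nlinarith [mul_le_mul_of_nonneg_left h (Nat.cast_nonneg (α := ℝ) n₁)]

/-- The hypercube obtained by varying the left factor. -/
lemma minimaxRisk_ge_dense (hτ : 0 < τ) (hb : 0 < b) (h₁ : 0 < n₁) (h₂ : 0 < n₂) (h₃ : 0 < n₃)
    (hr : 0 < r) (hr₂ : r ≤ n₂) (hrs : r ≤ s) (hm : 0 < m)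
    (hγ : (γ : ℝ) = (m : ℝ) / ((n₁ : ℝ) * n₂ * n₃)) :
    ENNReal.ofReal (1 / 8 * min (Delta n₂ n₃ s * b ^ 2)
      (τ ^ 2 * (((r : ℝ) * n₁ * n₃ / 2) / m))) ≤ minimaxRisk n₁ n₂ n₃ r b s γ τ := by
  have : NeZero n₃ := ⟨h₃.ne'⟩
  -- `B` has one nonzero entry in each of `t` columns, so `t ≤ s`; `r ≤ t` lets these columns meet
  -- all `r` columns of `A`.
  obtain ⟨t, ht⟩ : ∃ t, t = min s n₂ := ⟨_, rfl⟩
  have htn : t ≤ n₂ := ht ▸ min_le_right _ _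
  have hts : t ≤ s := ht ▸ min_le_left _ _
  have hrt : r ≤ t := ht ▸ le_min hrs hr₂
  have ht0 : 0 < t := hr.trans_le hrt
  let col : Fin n₂ → Fin r := fun j => ⟨j % r, Nat.mod_lt _ hr⟩
  let V : Finset (Fin n₂) := Finset.univ.filter fun j => j.1 < t
  have hV : V.card = t := by
    rw [Fin.card_filter_val_lt]; exact min_eq_right htn
  let S : Finset (Idx n₁ n₂ n₃) := Finset.univ ×ˢ V ×ˢ Finset.univ
  have hS : S.card = n₁ * (t * n₃) := by simp [S, hV]
  -- The entry `b` of `B` rescales `β / b` to `β`, while `β ≤ b` keeps `A` in `[0, 1]`.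
  let A : ℝ → (Fin n₁ × Fin r × Fin n₃ → Bool) → Tensor n₁ r n₃ := fun β ω i p k =>
    if ω (i, p, k) then β / b else 0
  let B : Tensor r n₂ n₃ := fun p j k => if p = col j ∧ k = 0 then (if j ∈ V then b else 0) else 0
  have hX : ∀ β ω (p : Idx n₁ n₂ n₃), tenProd (A β ω) B p.1 p.2.1 p.2.2 =
      if p ∈ S ∧ ω (p.1, col p.2.1, p.2.2) then β else 0 := fun β ω p => by
    have := tenProd_slice_right (A β ω) col (fun j => if j ∈ V then b else 0) p.1 p.2.1 p.2.2
    refine this.trans ?_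
    have hpS : p ∈ S ↔ p.2.1 ∈ V := by simp [S]
    by_cases h1 : p.2.1 ∈ V <;> by_cases h2 : ω (p.1, col p.2.1, p.2.2) <;>
      simp [hpS, h1, h2, A, hb.ne']
  refine minimaxRisk_ge_of_hypercube hτ hb.le (by positivity) hm hγ (2 * t / r) (by positivity) S
    (fun p => (p.1, col p.2.1, p.2.2)) (fun d => ?_) (fun β ω => tenProd (A β ω) B)
    (fun β hβ0 hβb ω => ⟨fun i j k => ?_, A β ω, B, rfl, fun i j k => ?_, fun i j k => ?_, ?_⟩)
    (fun β _ _ ω p => hX β ω p) _ _ ?_ ?_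
  · refine le_trans ?_ (card_filter_mod_le hr hrt d.2.1)
    have : ({p ∈ S | (p.1, col p.2.1, p.2.2) = d} : Finset _).card ≤
        ((Finset.range t).filter fun j => j % r = (d.2.1 : ℕ) % r).card := by
      refine Finset.card_le_card_of_injOn (fun p => (p.2.1 : ℕ)) ?_ ?_
      · rintro ⟨i, j, k⟩ hp
        simp only [Finset.coe_filter, Set.mem_ofPred_eq] at hp
        have hj : j.1 < t := by simpa [S, V] using hp.1
        simp [← hp.2, col, hj]
      · rintro ⟨i, j, k⟩ hp ⟨i', j', k'⟩ hp' h
        simp only [Finset.coe_filter, Set.mem_ofPred_eq] at hp hp'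
        have e := hp.2.trans hp'.2.symm
        simp only [Prod.mk.injEq] at e
        exact Prod.ext e.1 (Prod.ext (Fin.ext h) e.2.2)
    exact_mod_cast this
  · rw [hX β ω (i, j, k)]
    split_ifs <;> simp [hβ0]
  · dsimp only [A]
    split_ifs
    · exact ⟨by positivity, div_le_one_of_le₀ hβb hb.le⟩
    · simp
  · dsimp only [B]
    split_ifs <;> simp [hb.le]
  · refine le_trans ?_ hts
    have hsub : {p : Idx r n₂ n₃ | B p.1 p.2.1 p.2.2 ≠ 0} ⊆
        (V.image fun j => (col j, j, 0) : Finset (Idx r n₂ n₃)) := by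
      rintro ⟨p, j, k⟩ hp
      have h1 : p = col j ∧ k = 0 := by
        by_contra hc
        exact hp (if_neg hc)
      have h2 : j ∈ V := by
        by_contra hc
        exact hp (by simp [B, hc])
      simp [h1, h2]
    refine (Set.ncard_le_ncard hsub (Finset.finite_toSet _)).trans ?_
    rw [Set.ncard_coe_finset]
    exact Finset.card_image_le.trans hV.le
  · have h2' : (0 : ℝ) < n₂ := by exact_mod_cast h₂
    have h3' : (1 : ℝ) ≤ n₃ := by exact_mod_cast h₃
    -- Here `Δn₂ = min(n₂, s/n₃)`, which is at most `min(n₂, s)`.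
    have h : Delta n₂ n₃ s * n₂ ≤ t := by
      rw [Delta, ht, Nat.cast_min, min_mul_of_nonneg _ _ h2'.le, one_mul, min_comm]
      refine min_le_min_right _ ?_
      rw [div_mul_eq_mul_div, mul_comm (n₂ : ℝ), mul_div_mul_right _ _ h2'.ne']
      exact div_le_self (by positivity) h3'
    rw [hS]
    push_cast
    nlinarith [mul_le_mul_of_nonneg_left h (show (0 : ℝ) ≤ n₁ * n₃ by positivity)]
  · rw [hS]
    push_cast
    refine le_of_eq ?_
    field_simp

end SparseNTF

/-! ### Combination of the two bounds -/

theorem proposition5 :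
    ∃ C : ℝ, 0 < C ∧ ∃ βc : ℝ, 0 < βc ∧
      ∀ (n₁ n₂ n₃ r s m : ℕ) (b τ : ℝ) (γ : unitInterval),
        2 ≤ n₁ → 2 ≤ n₂ → 2 ≤ n₃ →
        r ≤ min n₁ n₂ → r ≤ s → s ≤ r * n₂ * n₃ →
        0 ≤ b → 0 < τ →
        1 ≤ m → m ≤ n₁ * n₂ * n₃ → (γ : ℝ) = (m : ℝ) / ((n₁ : ℝ) * n₂ * n₃) →
        ENNReal.ofReal (C * min (SparseNTF.Delta n₂ n₃ s * b ^ 2)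
            (βc ^ 2 * τ ^ 2 * (((s : ℝ) + (r : ℝ) * n₁ * n₃) / m))) ≤
          SparseNTF.minimaxRisk n₁ n₂ n₃ r b s γ τ := by
  -- `1/8` is the constant of the hypercube bound. `βc² = 1/16` lies below what the cubes give: the
  -- larger of `s` and `r n₁ n₃` is at least half the sum, and is counted with weight at least
  -- `1/4`.
  refine ⟨1 / 8, by norm_num, 1 / 4, by norm_num, ?_⟩
  intro n₁ n₂ n₃ r s m b τ γ h₁ h₂ h₃ hr hrs hs hb hτ hm _ hγ
  -- For `b = 0` the claimed bound is at most `0`; the dense cube divides by `b`.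
  rcases hb.eq_or_lt with rfl | hb'
  · refine le_trans (le_of_eq (ENNReal.ofReal_of_nonpos ?_)) zero_le
    exact mul_nonpos_of_nonneg_of_nonpos (by norm_num) ((min_le_left _ _).trans (by simp))
  rcases Nat.eq_zero_or_pos r with rfl | hr0
  · obtain rfl : s = 0 := by simpa using hs
    simp [SparseNTF.Delta]
  have hm' : (0 : ℝ) < m := by exact_mod_cast hm
  have hmono : ∀ e : ℝ, ((s : ℝ) + (r : ℝ) * n₁ * n₃) / 16 ≤ e →
      1 / 8 * min (SparseNTF.Delta n₂ n₃ s * b ^ 2)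
        ((1 / 4) ^ 2 * τ ^ 2 * (((s : ℝ) + (r : ℝ) * n₁ * n₃) / m)) ≤
      1 / 8 * min (SparseNTF.Delta n₂ n₃ s * b ^ 2) (τ ^ 2 * (e / m)) := fun e he => by
    refine mul_le_mul_of_nonneg_left (min_le_min_left _ ?_) (by norm_num)
    have := mul_le_mul_of_nonneg_left (div_le_div_of_nonneg_right he hm'.le) (sq_nonneg τ)
    refine le_trans (le_of_eq ?_) this
    ring
  have hs0 : (0 : ℝ) ≤ s := by positivity
  have hR0 : (0 : ℝ) ≤ (r : ℝ) * n₁ * n₃ := by positivity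
  rcases le_total ((r : ℝ) * n₁ * n₃) s with h | h
  · exact (ENNReal.ofReal_le_ofReal (hmono (s / 4) (by linarith))).trans
      (SparseNTF.minimaxRisk_ge_sparse hτ hb (by omega) (by omega) (by omega) hr0
        (hr.trans (min_le_left _ _)) hs hm hγ)
  · exact (ENNReal.ofReal_le_ofReal (hmono (r * n₁ * n₃ / 2) (by linarith))).trans
      (SparseNTF.minimaxRisk_ge_dense hτ hb' (by omega) (by omega) (by omega) hr0
        (hr.trans (min_le_right _ _)) hrs hm hγ)
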